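/- Let $l>0$, let $d_1,\dots,d_p>0$ and $D=\mathrm{diag}\{d_1,\dots,d_p\}$. Let $L^2_p(0,l)$ be the Hilbert space of square-integrable $\mathbb{C}^p$-valued functions on $(0,l)$, and let $A$ be the bounded operator on it given by $(Af)(x)=iD\int_0^x f(t)\,dt$. Let $Q(x,t)=Q_1(x)Q_2(t)$, where $Q_1$ and $Q_2$ are measurable complex matrix functions on $(0,l)$ of sizes $p\times\widehat p$ and $\widehat p\times p$. Suppose that a bounded operator $T$ on $L^2_p(0,l)$ satisfies $$TA-A^*T=i\int_0^l Q(x,t)\,\cdot\,dt ,$$ that is, for every $f\in L^2_p(0,l)$ the integral $\int_0^l Q(x,t)f(t)\,dt$ converges absolutely for almost every $x\in(0,l)$, and $\big((TA-A^*T)f\big)(x)=i\int_0^l Q(x,t)f(t)\,dt$ for almost every $x$. For $x,t\in[0,l]$ and $1\le i,j\le p$ put $$\Upsilon_{ij}(x,t)=\frac{1}{2d_id_j}\int_{d_ix+d_jt}^{f_{\min}}Q_{ij}\Big(\frac{u+d_ix-d_jt}{2d_i},\ \frac{u-d_ix+d_jt}{2d_j}\Big)\,du,$$ $$f_{\min}=\min\big(d_i(2l-x)+d_jt,\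 d_ix+d_j(2l-t)\big).$$ Then: 1. All the integrals defining $\Upsilon_{ij}(x,t)$, $x,t\in[0,l]$, converge absolutely. 2. For every $x\in[0,l]$ the matrix function $t\mapsto\Upsilon(x,t)=\{\Upsilon_{ij}(x,t)\}_{i,j=1}^p$ is absolutely continuous on $[0,l]$; in particular $\frac{\partial}{\partial t}\Upsilon(x,t)$ exists for almost every $t$. 3. For every $f\in L^2_p(0,l)$ $$Tf=\frac{d}{dx}\int_0^l\frac{\partial}{\partial t}\Upsilon(x,t)\,f(t)\,dt .$$ More precisely, for every $x\in[0,l]$ the integral on the right converges absolutely, it is an absolutely continuous function of $x\in[0,l]$, and its derivative is equal to $(Tf)(x)$ for almost every $x\in(0,l)$. -/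

import Mathlib

open MeasureTheory Set

/-- Lebesgue measure on the interval `(0, l)`. -/
noncomputable abbrev intervalMeasure (l : ℝ) : Measure ℝ := volume.restrict (Ioo 0 l)

/-- The Hilbert space `L²_p(0, l)` of square-integrable `ℂᵖ`-valued functions on `(0, l)`. -/
noncomputable abbrev L2Vec (p : ℕ) (l : ℝ) := Lp (EuclideanSpace ℂ (Fin p)) 2 (intervalMeasure l)

/-- The function `x ↦ ∫₀ˣ f(t) dt`. -/
noncomputable def primitiveFun {p : ℕ} {l : ℝ} (f : L2Vec p l) (x : ℝ) :
    EuclideanSpace ℂ (Fin p) := ∫ t in (0 : ℝ)..x, f t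

theorem L2Vec.integrable {p : ℕ} {l : ℝ} (f : L2Vec p l) : Integrable f (intervalMeasure l) :=
  (Lp.memLp f).integrable (by norm_num)

theorem L2Vec.intervalIntegrable {p : ℕ} {l : ℝ} (f : L2Vec p l) {x : ℝ} (hx : x ∈ Ioo 0 l) :
    IntervalIntegrable f volume 0 x := by
  rw [intervalIntegrable_iff_integrableOn_Ioc_of_le hx.1.le]
  have h : IntegrableOn f (Ioo 0 l) volume := L2Vec.integrable f
  exact h.mono_set fun t ht => ⟨ht.1, ht.2.trans_lt hx.2⟩

theorem primitiveFun_aestronglyMeasurable {p : ℕ} {l : ℝ} (f : L2Vec p l) :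
    AEStronglyMeasurable (primitiveFun f) (intervalMeasure l) := by
  have hc : Continuous fun x => ∫ t in (0 : ℝ)..x, f t ∂(intervalMeasure l) :=
    (L2Vec.integrable f).continuous_primitive 0
  refine hc.aestronglyMeasurable.congr ?_
  filter_upwards [ae_restrict_mem measurableSet_Ioo] with x hx
  have hs : Ioc 0 x ∩ Ioo 0 l = Ioc 0 x :=
    inter_eq_left.2 fun t ht => ⟨ht.1, ht.2.trans_lt hx.2⟩
  rw [primitiveFun, intervalIntegral.integral_of_le hx.1.le,
    intervalIntegral.integral_of_le hx.1.le, Measure.restrict_restrict measurableSet_Ioc, hs]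

theorem primitiveFun_norm_le {p : ℕ} {l : ℝ} (f : L2Vec p l) {x : ℝ} (hx : x ∈ Ioo 0 l) :
    ‖primitiveFun f x‖ ≤ (intervalMeasure l univ ^ (1 / 2 : ℝ)).toReal * ‖f‖ := by
  have h1 : ‖primitiveFun f x‖ ≤ ∫ t, ‖f t‖ ∂(intervalMeasure l) := by
    refine (intervalIntegral.norm_integral_le_integral_norm hx.1.le).trans ?_
    rw [intervalIntegral.integral_of_le hx.1.le]
    refine setIntegral_mono_set (L2Vec.integrable f).norm
      (Filter.Eventually.of_forall fun _ => norm_nonneg _) ?_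
    exact (show Ioc 0 x ⊆ Ioo 0 l from
      fun t ht => ⟨ht.1, ht.2.trans_lt hx.2⟩).eventuallyLE
  refine h1.trans ?_
  have h2 := eLpNorm_le_eLpNorm_mul_rpow_measure_univ (p := 1) (q := 2) (by norm_num)
    (Lp.memLp f).1
  rw [integral_norm_eq_lintegral_enorm (Lp.memLp f).1, ← eLpNorm_one_eq_lintegral_enorm,
    Lp.norm_def, mul_comm, ← ENNReal.toReal_mul]
  refine ENNReal.toReal_mono ?_ (h2.trans (le_of_eq ?_))
  · exact ENNReal.mul_ne_top (Lp.eLpNorm_ne_top f)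
      (ENNReal.rpow_ne_top_of_nonneg (by norm_num) (measure_ne_top _ _))
  · congr 2
    norm_num

theorem primitiveFun_memLp {p : ℕ} {l : ℝ} (f : L2Vec p l) :
    MemLp (primitiveFun f) 2 (intervalMeasure l) := by
  refine MemLp.of_bound (primitiveFun_aestronglyMeasurable f)
    ((intervalMeasure l univ ^ (1 / 2 : ℝ)).toReal * ‖f‖) ?_
  filter_upwards [ae_restrict_mem measurableSet_Ioo] with x hx
  exact primitiveFun_norm_le f hx

/-- The Volterra operator `f ↦ ∫₀ˣ f(t) dt` on `L²_p(0, l)`, as a bounded operator. -/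
noncomputable def volterra (p : ℕ) (l : ℝ) : L2Vec p l →L[ℂ] L2Vec p l :=
  LinearMap.mkContinuous
    { toFun := fun f => (primitiveFun_memLp f).toLp
      map_add' := by
        intro f g
        rw [← MemLp.toLp_add, MemLp.toLp_eq_toLp_iff]
        filter_upwards [ae_restrict_mem measurableSet_Ioo] with x hx
        simp only [primitiveFun, Pi.add_apply]
        rw [← intervalIntegral.integral_add (L2Vec.intervalIntegrable f hx)
          (L2Vec.intervalIntegrable g hx)]
        refine intervalIntegral.integral_congr_ae ?_
        have h : ∀ᵐ t ∂volume, t ∈ Ioo 0 l → (f + g) t = f t + g t :=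
          (ae_restrict_iff' measurableSet_Ioo).1 (Lp.coeFn_add f g)
        filter_upwards [h] with t ht hmem
        rw [uIoc_of_le hx.1.le] at hmem
        exact ht ⟨hmem.1, hmem.2.trans_lt hx.2⟩
      map_smul' := by
        intro c f
        rw [RingHom.id_apply, ← MemLp.toLp_const_smul, MemLp.toLp_eq_toLp_iff]
        filter_upwards [ae_restrict_mem measurableSet_Ioo] with x hx
        simp only [primitiveFun, Pi.smul_apply]
        rw [← intervalIntegral.integral_smul]
        refine intervalIntegral.integral_congr_ae ?_
        have h : ∀ᵐ t ∂volume, t ∈ Ioo 0 l → (c • f) t = c • f t :=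
          (ae_restrict_iff' measurableSet_Ioo).1 (Lp.coeFn_smul c f)
        filter_upwards [h] with t ht hmem
        rw [uIoc_of_le hx.1.le] at hmem
        exact ht ⟨hmem.1, hmem.2.trans_lt hx.2⟩ }
    ((measureUnivNNReal (intervalMeasure l) : ℝ) ^ ((2 : ENNReal).toReal)⁻¹ *
      (intervalMeasure l univ ^ (1 / 2 : ℝ)).toReal)
    (by
      intro f
      rw [mul_assoc]
      refine Lp.norm_le_of_ae_bound (by positivity) ?_
      have hm : (primitiveFun_memLp f).toLp (primitiveFun f) =ᵐ[intervalMeasure l] primitiveFun f :=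
        (primitiveFun_memLp f).coeFn_toLp
      filter_upwards [hm, ae_restrict_mem measurableSet_Ioo] with x hx hx'
      change ‖(primitiveFun_memLp f).toLp (primitiveFun f) x‖ ≤ _
      rw [hx]
      exact primitiveFun_norm_le f hx')

theorem volterra_apply (p : ℕ) (l : ℝ) (f : L2Vec p l) :
    volterra p l f =ᵐ[intervalMeasure l] fun x => ∫ t in (0 : ℝ)..x, f t :=
  (primitiveFun_memLp f).coeFn_toLp

/-- The diagonal matrix `D = diag(d₁, …, d_p)`, with complex entries. -/
noncomputable def matD {p : ℕ} (d : Fin p → ℝ) : Matrix (Fin p) (Fin p) ℂ :=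
  Matrix.diagonal fun i => (d i : ℂ)

/-- The bounded operator `A = i D ∫₀ˣ · dt` on `L²_p(0, l)`. -/
noncomputable def opA {p : ℕ} (d : Fin p → ℝ) (l : ℝ) : L2Vec p l →L[ℂ] L2Vec p l :=
  Complex.I • ((Matrix.toEuclideanCLM (𝕜 := ℂ) (matD d)).compLpL 2 (intervalMeasure l)).comp
    (volterra p l)

theorem opA_apply {p : ℕ} (d : Fin p → ℝ) (l : ℝ) (f : L2Vec p l) :
    opA d l f =ᵐ[intervalMeasure l]
      fun x => Complex.I • Matrix.toEuclideanLin (matD d) (∫ t in (0 : ℝ)..x, f t) := by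
  have h1 := Lp.coeFn_smul Complex.I
    ((Matrix.toEuclideanCLM (𝕜 := ℂ) (matD d)).compLpL 2 (intervalMeasure l) (volterra p l f))
  have h2 := ContinuousLinearMap.coeFn_compLpL (p := 2) (μ := intervalMeasure l)
    (Matrix.toEuclideanCLM (𝕜 := ℂ) (matD d)) (volterra p l f)
  filter_upwards [h1, h2, volterra_apply p l f] with x h1 h2 h3
  change (Complex.I • ((Matrix.toEuclideanCLM (𝕜 := ℂ) (matD d)).compLpL 2
    (intervalMeasure l) (volterra p l f)) : L2Vec p l) x = _
  rw [h1, Pi.smul_apply, h2, h3]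
  rfl

/-- `R = ∫₀ˡ K(x, t) · dt`: for each `f`, the integral `∫₀ˡ K(x, t) f(t) dt` converges absolutely
for almost every `x` and equals `(R f)(x)` for almost every `x`. -/
def IsIntegralOperator {p : ℕ} {l : ℝ} (R : L2Vec p l →L[ℂ] L2Vec p l)
    (K : ℝ → ℝ → Matrix (Fin p) (Fin p) ℂ) : Prop :=
  ∀ f : L2Vec p l,
    (∀ᵐ x ∂(intervalMeasure l),
      Integrable (fun t => Matrix.toEuclideanLin (K x t) (f t)) (intervalMeasure l)) ∧
    R f =ᵐ[intervalMeasure l]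
      fun x => ∫ t, Matrix.toEuclideanLin (K x t) (f t) ∂(intervalMeasure l)

/-- `min (d_i (2l - x) + d_j t, d_i x + d_j (2l - t))`. -/
noncomputable def fMin {p : ℕ} (d : Fin p → ℝ) (l : ℝ) (i j : Fin p) (x t : ℝ) : ℝ :=
  min (d i * (2 * l - x) + d j * t) (d i * x + d j * (2 * l - t))

/-- The integrand of `Υ_ij(x, t)`. -/
noncomputable def upsilonIntegrand {p : ℕ} (d : Fin p → ℝ)
    (Q : ℝ → ℝ → Matrix (Fin p) (Fin p) ℂ) (i j : Fin p) (x t u : ℝ) : ℂ :=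
  Q ((u + d i * x - d j * t) / (2 * d i)) ((u - d i * x + d j * t) / (2 * d j)) i j

/-- The matrix function `Υ(x, t)`. -/
noncomputable def upsilon {p : ℕ} (d : Fin p → ℝ) (l : ℝ)
    (Q : ℝ → ℝ → Matrix (Fin p) (Fin p) ℂ) (x t : ℝ) : Matrix (Fin p) (Fin p) ℂ :=
  Matrix.of fun i j => (2 * (d i : ℂ) * (d j : ℂ))⁻¹ *
    ∫ u in (d i * x + d j * t)..(fMin d l i j x t), upsilonIntegrand d Q i j x t u

/-- The entrywise partial derivative `∂Υ/∂t (x, t)`. -/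
noncomputable def dtUpsilon {p : ℕ} (d : Fin p → ℝ) (l : ℝ)
    (Q : ℝ → ℝ → Matrix (Fin p) (Fin p) ℂ) (x t : ℝ) : Matrix (Fin p) (Fin p) ℂ :=
  Matrix.of fun i j => deriv (fun τ => upsilon d l Q x τ i j) t

/-! Write `σ_j(t) = 1_{(t,∞)} e_j` and `ρ_j(t) = (s - t)⁺ e_j`. For `t ≥ 0` the operator `A` sends
`σ_j(t)` to `i d_j ρ_j(t)`, and in `L²` the derivative of `ρ_j` is `-σ_j`. Tested on `σ_i(x)` and
`σ_j(t)`, the operator identity therefore becomes a transport equation for `G(x, t) = ⟪ρ_i(x), T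
ρ_j(t)⟫`: `-(d_j ∂ₓ + d_i ∂ₜ) G = ∑ₖ αₖ(x) βₖ(t)`, where `αₖ`, `βₖ` are tail integrals of factors
`aₖ`, `bₖ` of `Q_ij` (`inner_ramp_step_identity`).

Since `G = 0` for `x ≥ l`, integration along the characteristics `(x + d_j w, t + d_i w)` determines
`G` (`inner_rampVec_eq_sum_integral`). Differentiating in `x` and then in `t` gives `⟪σ_i(x), T
σ_j(t)⟫ = ∑ₖ ∫ aₖ(x + d_j w) bₖ(t + d_i w) dw` (`inner_stepVec_eq_sum_integral`), and the
substitution `u = d_i x + d_j t + 2 d_i d_j w` identifies the right side with `Υ_ij(x, t)`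
(`upsilon_eq_sum_integral`).

Hence `Υ_ij(x, ·)` is the tail integral of the conjugate of `(T* σ_i(x))_j`, which gives absolute
continuity. The `i`-th component of `∫ ∂ₜΥ f` is `-⟪T* σ_i(x), f⟫ = -∫ₓˡ (T f)_i`, whose derivative
in `x` is `(T f)_i`.

The obstacle is that `Q₁`, `Q₂` are only measurable, while these integrals need factors in `L²`.
`exists_memLp_factors` supplies them by projecting to suitable subspaces. -/

/-! ### Square integrability from duality -/

/-- A function whose product with every square-integrable function is integrable is
square-integrable. -/
theorem memLp_two_of_forall_integrable_mul {α : Type*} [MeasurableSpace α] {μ : Measure α}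
    [IsFiniteMeasure μ] {g : α → ℂ} (hg : AEMeasurable g μ)
    (h : ∀ f : Lp ℂ 2 μ, Integrable (fun x => g x * f x) μ) : MemLp g 2 μ := by
  wlog hgm : Measurable g generalizing g
  · have h1 : MemLp (hg.mk g) 2 μ := by
      refine this hg.measurable_mk.aemeasurable (fun f => (h f).congr ?_) hg.measurable_mk
      filter_upwards [hg.ae_eq_mk] with x hx
      rw [hx]
    exact (memLp_congr_ae hg.ae_eq_mk).2 h1
  -- The truncations are bounded, so their conjugates `G n` lie in `L²`. For each `f` the pairings
  -- are at most `∫ |g f|`, so Banach–Steinhaus bounds the norms of `G n` uniformly, and the bound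
  -- passes to the pointwise limit.
  let gn : ℕ → α → ℂ := fun n => {x | ‖g x‖ ≤ n}.indicator g
  have hS : ∀ n : ℕ, MeasurableSet {x | ‖g x‖ ≤ n} := fun n =>
    measurableSet_le hgm.norm measurable_const
  have hle : ∀ n x, ‖gn n x‖ ≤ ‖g x‖ := fun n x => norm_indicator_le_norm_self _ _
  have hgn : ∀ n, MemLp (fun x => (starRingEnd ℂ) (gn n x)) 2 μ := fun n => by
    refine MemLp.of_bound (C := n)
      (Complex.continuous_conj.measurable.comp (hgm.indicator (hS n))).aestronglyMeasurable
      (Filter.Eventually.of_forall fun x => ?_)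
    rw [RCLike.norm_conj]
    by_cases hx : ‖g x‖ ≤ n
    · exact (hle n x).trans hx
    · simp [gn, indicator_of_notMem (show x ∉ {x | ‖g x‖ ≤ n} from hx)]
  let G : ℕ → Lp ℂ 2 μ := fun n => (hgn n).toLp
  obtain ⟨C, hC⟩ := banach_steinhaus (g := fun n => innerSL ℂ (G n)) (fun f => by
    refine ⟨∫ x, ‖g x * f x‖ ∂μ, fun n => ?_⟩
    rw [innerSL_apply_apply, L2.inner_def]
    refine norm_integral_le_of_norm_le (h f).norm ?_
    filter_upwards [(hgn n).coeFn_toLp] with x hx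
    rw [hx, RCLike.inner_apply, RCLike.conj_conj, norm_mul, norm_mul, mul_comm]
    gcongr
    exact hle n x)
  refine ⟨hgm.aestronglyMeasurable, lt_of_le_of_lt
    (Lp.eLpNorm_le_of_ae_tendsto (C := ENNReal.ofReal C) (u := Filter.atTop) (f := gn) ?_
      (fun n => (hgm.indicator (hS n)).aestronglyMeasurable) ?_) ENNReal.ofReal_lt_top⟩
  · refine Filter.Eventually.of_forall fun n => ?_
    have h1 : eLpNorm (gn n) 2 μ = eLpNorm (G n) 2 μ := by
      rw [eLpNorm_congr_ae (hgn n).coeFn_toLp]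
      exact eLpNorm_congr_norm_ae (Filter.Eventually.of_forall fun x => by simp)
    rw [h1, ← ENNReal.ofReal_toReal (Lp.eLpNorm_ne_top (G n)), ← Lp.norm_def]
    refine ENNReal.ofReal_le_ofReal ?_
    simpa using hC n
  · refine Filter.Eventually.of_forall fun x => ?_
    refine tendsto_const_nhds.congr' ?_
    filter_upwards [Filter.eventually_ge_atTop ⌈‖g x‖⌉₊] with n hn
    exact (indicator_of_mem (show x ∈ {x | ‖g x‖ ≤ n} from Nat.ceil_le.1 hn) g).symm

/-! ### Primitives, translations and tail integrals -/

theorem AbsolutelyContinuousOnInterval.of_dist_le {X Y : Type*} [PseudoMetricSpace X]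
    [PseudoMetricSpace Y] {f : ℝ → X} {g : ℝ → Y} {a b : ℝ}
    (hg : AbsolutelyContinuousOnInterval g a b)
    (h : ∀ x ∈ uIcc a b, ∀ y ∈ uIcc a b, dist (f x) (f y) ≤ dist (g x) (g y)) :
    AbsolutelyContinuousOnInterval f a b := by
  rw [absolutelyContinuousOnInterval_iff] at hg ⊢
  intro ε hε
  obtain ⟨δ, hδ, H⟩ := hg ε hε
  refine ⟨δ, hδ, fun E hE hlt => lt_of_le_of_lt (Finset.sum_le_sum fun i hi => ?_) (H E hE hlt)⟩
  exact h _ (hE.1 i hi).1 _ (hE.1 i hi).2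

/-- The primitive of an integrable vector-valued function is absolutely continuous. -/
theorem IntervalIntegrable.absolutelyContinuousOnInterval_primitive {E : Type*}
    [NormedAddCommGroup E] [NormedSpace ℝ E] {f : ℝ → E} {a b : ℝ}
    (hf : IntervalIntegrable f volume a b) :
    AbsolutelyContinuousOnInterval (fun x => ∫ t in a..x, f t) a b := by
  refine (hf.norm.absolutelyContinuousOnInterval_intervalIntegral left_mem_uIcc).of_dist_le ?_
  intro x hx y hy
  have hi : ∀ z ∈ uIcc a b, IntervalIntegrable f volume a z := fun z hz =>
    hf.mono_set (uIcc_subset_uIcc left_mem_uIcc hz)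
  rw [dist_eq_norm, dist_eq_norm, intervalIntegral.integral_interval_sub_left (hi x hx) (hi y hy),
    intervalIntegral.integral_interval_sub_left (hi x hx).norm (hi y hy).norm, Real.norm_eq_abs]
  exact intervalIntegral.norm_integral_le_abs_integral_norm

theorem MemLp.comp_mul_add {a : ℝ → ℂ} (ha : MemLp a 2 volume) (ham : Measurable a) {c : ℝ}
    (hc : c ≠ 0) (x : ℝ) : MemLp (fun w => a (x + c * w)) 2 volume := by
  have hm : Measurable fun w => a (x + c * w) := ham.comp (by fun_prop)
  rw [memLp_two_iff_integrable_sq_norm hm.aestronglyMeasurable]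
  exact (((memLp_two_iff_integrable_sq_norm ham.aestronglyMeasurable).1 ha).comp_add_left
    x).comp_mul_left' hc

/-- Translations act continuously on square-integrable functions, weak form. -/
theorem continuous_integral_translate_mul {a g : ℝ → ℂ} (ha : MemLp a 2 volume)
    (ham : Measurable a) (hg : MemLp g 2 volume) {c : ℝ} (hc : c ≠ 0) :
    Continuous fun x => ∫ w, a (x + c * w) * g w := by
  have hac : MemLp (fun w => a (c * w)) 2 volume := by
    simpa using MemLp.comp_mul_add ha ham hc 0
  -- Since `x + c w = c (w + x / c)`, the dependence on `x` is a translation of the fixed `L²`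
  -- function `a (c ·)`, and translations are strongly continuous on `L²`.
  let τ : ℝ → C(ℝ, ℝ) := fun x => ⟨fun w => w + x / c, by fun_prop⟩
  have hτ : Continuous τ := by
    refine ContinuousMap.continuous_of_continuous_uncurry _ ?_
    change Continuous fun p : ℝ × ℝ => p.2 + p.1 / c
    fun_prop
  have hτm : ∀ x, MeasurePreserving (τ x) volume volume := fun x =>
    measurePreserving_add_right volume (x / c)
  have h1 : Continuous fun x => Lp.compMeasurePreserving (τ x) (hτm x) hac.toLp :=
    continuous_const.compMeasurePreservingLp hτ hτm (by norm_num)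
  have h2 : Continuous fun x => inner ℂ (hg.star.toLp (star g))
      (Lp.compMeasurePreserving (τ x) (hτm x) hac.toLp) := continuous_const.inner h1
  convert! h2 using 2 with x
  rw [L2.inner_def]
  refine integral_congr_ae ?_
  filter_upwards [hg.star.coeFn_toLp, Lp.coeFn_compMeasurePreserving hac.toLp (hτm x),
    (hτm x).quasiMeasurePreserving.ae hac.coeFn_toLp] with w h1 h2 h3
  rw [h1, h2, Function.comp_apply, h3, RCLike.inner_apply]
  simp [τ, mul_add, mul_div_cancel₀ _ hc, add_comm]

theorem integral_Ioi_eq_sub_intervalIntegral {a : ℝ → ℂ} (ha : Integrable a) (x y : ℝ) :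
    ∫ s in Ioi y, a s = (∫ s in Ioi x, a s) - ∫ σ in x..y, a σ := by
  rw [← intervalIntegral.integral_Ioi_sub_Ioi' ha.integrableOn ha.integrableOn, sub_sub_cancel]

theorem continuous_integral_Ioi {a : ℝ → ℂ} (ha : Integrable a) :
    Continuous fun x => ∫ s in Ioi x, a s := by
  rw [funext fun x => integral_Ioi_eq_sub_intervalIntegral ha 0 x]
  exact continuous_const.sub (ha.continuous_primitive 0)

theorem norm_integral_Ioi_le {a : ℝ → ℂ} (ha : Integrable a) (x : ℝ) :
    ‖∫ s in Ioi x, a s‖ ≤ ∫ s, ‖a s‖ :=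
  (norm_integral_le_integral_norm _).trans
    (setIntegral_le_integral ha.norm (Filter.Eventually.of_forall fun _ => norm_nonneg _))

/-- Differentiation of a pairing with a translated tail integral. -/
theorem hasDerivAt_integral_tail_translate_mul {a g : ℝ → ℂ} (ha : MemLp a 2 volume)
    (ha1 : Integrable a) (ham : Measurable a) (hg : MemLp g 2 volume) (hg1 : Integrable g) {c : ℝ}
    (hc : c ≠ 0) (x : ℝ) :
    HasDerivAt (fun x => ∫ w, (∫ y in Ioi (x + c * w), a y) * g w)
      (-∫ w, a (x + c * w) * g w) x := by
  set J : ℝ → ℂ := fun x => ∫ w, a (x + c * w) * g w with hJ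
  have hJc : Continuous J := continuous_integral_translate_mul ha ham hg hc
  have htail : ∀ y w, ∫ s in Ioi (y + c * w), a s =
      (∫ s in Ioi (x + c * w), a s) - ∫ σ in x..y, a (σ + c * w) := fun y w => by
    rw [intervalIntegral.integral_comp_add_right (fun s => a s) (c * w),
      integral_Ioi_eq_sub_intervalIntegral ha1 (x + c * w)]
  have hint : Integrable (fun w => (∫ y in Ioi (x + c * w), a y) * g w) :=
    hg1.bdd_mul ((continuous_integral_Ioi ha1).comp (by fun_prop :
      Continuous fun w => x + c * w)).aestronglyMeasurable
      (Filter.Eventually.of_forall fun w => norm_integral_Ioi_le ha1 _)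
  have hprod : ∀ y, Integrable (Function.uncurry fun σ w => a (σ + c * w) * g w)
      ((volume.restrict (uIoc x y)).prod volume) := fun y => by
    have hm : AEStronglyMeasurable (Function.uncurry fun σ w => a (σ + c * w) * g w)
        ((volume : Measure ℝ).prod volume) :=
      ((ham.comp (by fun_prop : Measurable fun p : ℝ × ℝ => p.1 + c * p.2)).aestronglyMeasurable).mul
        hg.1.comp_snd
    have hI : Integrable (Function.uncurry fun σ w => a (σ + c * w) * g w)
        ((volume : Measure ℝ).prod volume) := by
      refine (integrable_prod_iff' hm).2 ⟨Filter.Eventually.of_forall fun w =>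
        (ha1.comp_add_right (c * w)).mul_const (g w), ?_⟩
      have h1 : ∀ w, ∫ σ, ‖Function.uncurry (fun σ w => a (σ + c * w) * g w) (σ, w)‖ =
          (∫ σ, ‖a σ‖) * ‖g w‖ := fun w => by
        simp only [Function.uncurry, norm_mul]
        rw [integral_mul_const, integral_add_right_eq_self (fun σ => ‖a σ‖)]
      simp_rw [h1]
      exact hg1.norm.const_mul _
    have h2 := hI.restrict (s := uIoc x y ×ˢ univ)
    rwa [← Measure.prod_restrict, Measure.restrict_univ] at h2
  -- As `a` need not be continuous, the integrand is not differentiated pointwise. Fubini instead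
  -- presents the pairing as a constant minus a primitive of the continuous function `J`.
  have hF : (fun y => ∫ w, (∫ s in Ioi (y + c * w), a s) * g w) = fun y =>
      (∫ w, (∫ s in Ioi (x + c * w), a s) * g w) - ∫ σ in x..y, J σ := by
    funext y
    have hsw : ∫ w, (∫ σ in x..y, a (σ + c * w)) * g w = ∫ σ in x..y, J σ := by
      simp_rw [hJ, ← intervalIntegral.integral_mul_const]
      exact (intervalIntegral_integral_swap (hprod y)).symm
    have hint2 : Integrable fun w => (∫ σ in x..y, a (σ + c * w)) * g w := by
      simp_rw [← intervalIntegral.integral_mul_const,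
        intervalIntegral.intervalIntegral_eq_integral_uIoc]
      -- The scalar is the sign of the oriented integral over `x..y`.
      exact (hprod y).integral_prod_right.smul (if x ≤ y then (1 : ℝ) else -1)
    simp_rw [htail y, sub_mul]
    rw [integral_sub hint hint2, hsw]
  rw [hF]
  exact (intervalIntegral.integral_hasDerivAt_right (hJc.intervalIntegrable _ _)
    (hJc.stronglyMeasurableAtFilter _ _) hJc.continuousAt).const_sub _

/-! ### Square-integrable factors of a finite-rank kernel -/

/-- A function with values in a finite-dimensional space has a smallest subspace that contains
almost all of its values. -/
theorem exists_least_submodule_ae_mem {α V : Type*} [MeasurableSpace α] (μ : Measure α)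
    [AddCommGroup V] [Module ℂ V] [FiniteDimensional ℂ V] (u : α → V) :
    ∃ E : Submodule ℂ V, (∀ᵐ x ∂μ, u x ∈ E) ∧
      ∀ E' : Submodule ℂ V, (∀ᵐ x ∂μ, u x ∈ E') → E ≤ E' := by
  -- A minimal subspace is least: its intersection with any other admissible subspace is again
  -- admissible.
  obtain ⟨E, hE, hmin⟩ := exists_minimal_of_wellFoundedLT
    (fun E : Submodule ℂ V => ∀ᵐ x ∂μ, u x ∈ E) ⟨⊤, by simp⟩
  refine ⟨E, hE, fun E' hE' => ?_⟩
  refine (hmin (y := E ⊓ E') ?_ inf_le_left).trans inf_le_right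
  filter_upwards [hE, hE'] with x h1 h2 using ⟨h1, h2⟩

theorem inner_starProjection_left_of_mem {V : Type*} [NormedAddCommGroup V]
    [InnerProductSpace ℂ V] (E : Submodule ℂ V) [E.HasOrthogonalProjection] (v : V) {u : V}
    (hu : u ∈ E) : inner ℂ (E.starProjection v) u = inner ℂ v u := by
  rw [Submodule.inner_starProjection_left_eq_right, Submodule.starProjection_eq_self_iff.2 hu]

/-- If all the functions `⟪e, u⟫`, `e ∈ E`, are in `Lᵖ`, then so is the orthogonal projection of
`u` to `E`. -/
theorem memLp_starProjection {α : Type*} [MeasurableSpace α] {μ : Measure α} {q : ℕ}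
    (E : Submodule ℂ (EuclideanSpace ℂ (Fin q))) {u : α → EuclideanSpace ℂ (Fin q)}
    (h : ∀ e ∈ E, MemLp (fun x => inner ℂ e (u x)) 2 μ) :
    MemLp (fun x => E.starProjection (u x)) 2 μ := by
  refine MemLp.of_eval_piLp fun k => ?_
  have h1 := h _ (E.starProjection_apply_mem (EuclideanSpace.single k 1))
  simp_rw [Submodule.inner_starProjection_left_eq_right] at h1
  simpa [EuclideanSpace.inner_single_left] using h1

/-- A finite-rank kernel that defines an operator on `L²` is almost everywhere equal to a
finite-rank kernel with square-integrable factors. -/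
theorem exists_memLp_factors {α : Type*} [MeasurableSpace α] {μ : Measure α} [IsFiniteMeasure μ]
    {q : ℕ} {u v : α → EuclideanSpace ℂ (Fin q)} (hv : AEStronglyMeasurable v μ)
    (h1 : ∀ f : Lp ℂ 2 μ, ∀ᵐ x ∂μ, Integrable (fun t => inner ℂ (v t) (u x) * f t) μ)
    (h2 : ∀ f : Lp ℂ 2 μ, MemLp (fun x => ∫ t, inner ℂ (v t) (u x) * f t ∂μ) 2 μ) :
    ∃ w z : α → EuclideanSpace ℂ (Fin q), MemLp w 2 μ ∧ MemLp z 2 μ ∧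
      ∃ S ∈ ae μ, ∃ S' ∈ ae μ, ∀ x ∈ S, ∀ t ∈ S', inner ℂ (v t) (u x) = inner ℂ (w t) (z x) := by
  obtain ⟨E, hE, hmin⟩ := exists_least_submodule_ae_mem μ u
  have hEv : ∀ e ∈ E, MemLp (fun t => inner ℂ (v t) e) 2 μ := fun e he => by
    refine memLp_two_of_forall_integrable_mul (hv.inner aestronglyMeasurable_const).aemeasurable
      fun f => ?_
    -- The exceptional null set in `h1` depends on `f`, so no single `x` serves all `f`. For fixed
    -- `f` the good vectors form a subspace containing almost all `u x`, hence containing `E`.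
    let Ef : Submodule ℂ (EuclideanSpace ℂ (Fin q)) :=
      { carrier := {e | Integrable (fun t => inner ℂ (v t) e * f t) μ}
        add_mem' := fun {a b} ha hb => by
          simp only [mem_ofPred_eq, inner_add_right, add_mul]
          exact ha.add hb
        zero_mem' := by simp
        smul_mem' := fun c a ha => by
          simp only [mem_ofPred_eq, inner_smul_right, mul_assoc]
          exact ha.const_mul c }
    exact hmin Ef (h1 f) he
  set w : α → EuclideanSpace ℂ (Fin q) := fun t => E.starProjection (v t) with hw
  have hwL : MemLp w 2 μ := memLp_starProjection E fun e he => by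
    convert! (hEv e he).star using 1
    funext t
    exact (inner_conj_symm _ _).symm
  have hvw : ∀ x, u x ∈ E → ∀ t, inner ℂ (v t) (u x) = inner ℂ (w t) (u x) := fun x hx t =>
    (inner_starProjection_left_of_mem E (v t) hx).symm
  let F : Submodule ℂ (EuclideanSpace ℂ (Fin q)) :=
    { carrier := {c | MemLp (fun x => inner ℂ c (u x)) 2 μ}
      add_mem' := fun {a b} ha hb => by
        simp only [mem_ofPred_eq, inner_add_left]
        exact ha.add hb
      zero_mem' := by simp
      smul_mem' := fun c a ha => by
        simp only [mem_ofPred_eq, inner_smul_left]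
        exact ha.const_mul _ }
  have hwi : Integrable w μ := hwL.integrable (by norm_num)
  -- Applied to the indicator of `s`, the kernel gives `⟪∫ₛ w, u x⟫` for almost every `x`, and `h2`
  -- puts this in `L²`.
  have hs : ∀ s, MeasurableSet s → ∫ t in s, w t ∂μ ∈ F := fun s hs => by
    refine (memLp_congr_ae ?_).1 (h2 (indicatorConstLp 2 hs (measure_ne_top μ s) 1))
    filter_upwards [hE] with x hx
    rw [← inner_conj_symm, ← integral_inner hwi.integrableOn, ← integral_conj,
      ← integral_indicator hs]
    refine integral_congr_ae ?_
    filter_upwards [indicatorConstLp_coeFn (p := 2) (hs := hs) (hμs := measure_ne_top μ s)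
      (c := (1 : ℂ))] with t ht
    rw [ht, hvw x hx]
    by_cases hts : t ∈ s <;> simp [hts]
  -- The component of `w` orthogonal to `F` has zero integral over every measurable set, so it
  -- vanishes almost everywhere.
  have hwF : ∀ᵐ t ∂μ, w t ∈ F := by
    let P := ContinuousLinearMap.id ℂ (EuclideanSpace ℂ (Fin q)) - F.starProjection
    have h0 : (fun t => P (w t)) =ᵐ[μ] 0 := by
      refine (P.integrable_comp hwi).ae_eq_zero_of_forall_setIntegral_eq_zero fun s hms _ => ?_
      rw [P.integral_comp_comm hwi.integrableOn]
      simp [P, Submodule.starProjection_eq_self_iff.2 (hs s hms)]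
    filter_upwards [h0] with t ht
    exact Submodule.starProjection_eq_self_iff.1 (sub_eq_zero.1 ht).symm
  refine ⟨w, fun x => F.starProjection (u x), hwL, memLp_starProjection F fun e he => he,
    _, hE, _, hwF, fun x hx t ht => ?_⟩
  rw [hvw x hx, ← Submodule.inner_starProjection_left_eq_right,
    Submodule.starProjection_eq_self_iff.2 ht]

/-! ### Scalar entries of the matrix kernel -/

theorem toEuclideanLin_smul_single {p : ℕ} (M : Matrix (Fin p) (Fin p) ℂ) (c : ℂ) (i j : Fin p) :
    Matrix.toEuclideanLin M (c • EuclideanSpace.single j (1 : ℂ)) i = M i j * c := by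
  rw [map_smul, Matrix.toLpLin_apply]
  simp [mul_comm]

/-- The element `f e_j` of `L²_p(0, l)`. -/
noncomputable def L2Vec.ofCoord {p : ℕ} {l : ℝ} (j : Fin p) :
    Lp ℂ 2 (intervalMeasure l) →L[ℂ] L2Vec p l :=
  (ContinuousLinearMap.toSpanSingleton ℂ (EuclideanSpace.single j (1 : ℂ))).compLpL 2
    (intervalMeasure l)

theorem L2Vec.coeFn_ofCoord {p : ℕ} {l : ℝ} (j : Fin p) (f : Lp ℂ 2 (intervalMeasure l)) :
    L2Vec.ofCoord j f =ᵐ[intervalMeasure l] fun t => f t • EuclideanSpace.single j (1 : ℂ) :=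
  ContinuousLinearMap.coeFn_compLpL _ _

theorem IsIntegralOperator.ae_integrable_entry_mul {p : ℕ} {l : ℝ} {R : L2Vec p l →L[ℂ] L2Vec p l}
    {K : ℝ → ℝ → Matrix (Fin p) (Fin p) ℂ} (h : IsIntegralOperator R K) (i j : Fin p)
    (f : Lp ℂ 2 (intervalMeasure l)) :
    ∀ᵐ x ∂(intervalMeasure l), Integrable (fun t => K x t i j * f t) (intervalMeasure l) := by
  filter_upwards [(h (L2Vec.ofCoord j f)).1] with x hx
  refine (hx.eval_piLp i).congr ?_
  filter_upwards [L2Vec.coeFn_ofCoord j f] with t ht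
  rw [ht, toEuclideanLin_smul_single]

theorem IsIntegralOperator.apply_ofCoord {p : ℕ} {l : ℝ} {R : L2Vec p l →L[ℂ] L2Vec p l}
    {K : ℝ → ℝ → Matrix (Fin p) (Fin p) ℂ} (h : IsIntegralOperator R K) (i j : Fin p)
    (f : Lp ℂ 2 (intervalMeasure l)) :
    (fun x => R (L2Vec.ofCoord j f) x i) =ᵐ[intervalMeasure l]
      fun x => ∫ t, K x t i j * f t ∂(intervalMeasure l) := by
  filter_upwards [(h (L2Vec.ofCoord j f)).1, (h (L2Vec.ofCoord j f)).2] with x hx hx'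
  rw [hx', eval_integral_piLp fun i => hx.eval_piLp i]
  refine integral_congr_ae ?_
  filter_upwards [L2Vec.coeFn_ofCoord j f] with t ht
  rw [ht, toEuclideanLin_smul_single]

/-- Extension by zero allows translates on the whole line; the vanishing off `(0, l)` later takes
over the role of the cut-off `fMin`. -/
theorem exists_measurable_zero_extension {l : ℝ} {f : ℝ → ℂ} (hf : MemLp f 2 (intervalMeasure l)) :
    ∃ g : ℝ → ℂ, Measurable g ∧ MemLp g 2 volume ∧ (∀ x ∉ Ioo 0 l, g x = 0) ∧
      f =ᵐ[intervalMeasure l] g := by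
  have hm := hf.1.stronglyMeasurable_mk.measurable
  refine ⟨(Ioo 0 l).indicator (hf.1.mk f), hm.indicator measurableSet_Ioo,
    (memLp_indicator_iff_restrict measurableSet_Ioo).2 ((memLp_congr_ae hf.1.ae_eq_mk).1 hf),
    fun x hx => indicator_of_notMem hx _, ?_⟩
  filter_upwards [hf.1.ae_eq_mk, ae_restrict_mem measurableSet_Ioo] with x hx hx'
  rw [indicator_of_mem hx', hx]

/-- Equality on a product of two sets of full measure, not merely almost everywhere in the plane, is
essential: `Υ` integrates `Q` along segments, which are null sets of the plane. -/
theorem exists_kernel_factors {p q : ℕ} {l : ℝ} {Q₁ : ℝ → Matrix (Fin p) (Fin q) ℂ}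
    {Q₂ : ℝ → Matrix (Fin q) (Fin p) ℂ}
    (hQ₂ : ∀ k j, AEMeasurable (fun t => Q₂ t k j) (intervalMeasure l))
    {Q : ℝ → ℝ → Matrix (Fin p) (Fin p) ℂ} (hQ : ∀ x t, Q x t = Q₁ x * Q₂ t)
    {R : L2Vec p l →L[ℂ] L2Vec p l} (hR : IsIntegralOperator R fun x t => Complex.I • Q x t)
    (i j : Fin p) :
    ∃ a b : Fin q → ℝ → ℂ,
      (∀ k, Measurable (a k) ∧ MemLp (a k) 2 volume ∧ ∀ x ∉ Ioo 0 l, a k x = 0) ∧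
      (∀ k, Measurable (b k) ∧ MemLp (b k) 2 volume ∧ ∀ x ∉ Ioo 0 l, b k x = 0) ∧
      ∃ S ∈ ae (intervalMeasure l), ∃ S' ∈ ae (intervalMeasure l),
        ∀ x ∈ S, ∀ t ∈ S', Q x t i j = ∑ k, a k x * b k t := by
  let u : ℝ → EuclideanSpace ℂ (Fin q) := fun x => WithLp.toLp 2 fun k => Q₁ x i k
  -- The conjugation compensates for the conjugate-linear first slot of the inner product.
  let v : ℝ → EuclideanSpace ℂ (Fin q) := fun t => WithLp.toLp 2 fun k => star (Q₂ t k j)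
  have hv : AEStronglyMeasurable v (intervalMeasure l) := by
    refine AEMeasurable.aestronglyMeasurable ((PiLp.continuous_toLp 2 _).measurable.comp_aemeasurable
      (aemeasurable_pi_lambda _ fun k => ?_))
    exact Complex.continuous_conj.measurable.comp_aemeasurable (hQ₂ k j)
  have huv : ∀ x t, Q x t i j = inner ℂ (v t) (u x) := fun x t => by
    rw [hQ, Matrix.mul_apply, PiLp.inner_apply]
    simp [u, v, RCLike.inner_apply]
  have hI : ∀ x t, Q x t i j = -Complex.I * (Complex.I • Q x t) i j := fun x t => by
    rw [Matrix.smul_apply, smul_eq_mul, ← mul_assoc]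
    simp
  obtain ⟨w, z, hw, hz, S, hS, S', hS', hSS⟩ := exists_memLp_factors (u := u) hv
    (fun f => by
      filter_upwards [hR.ae_integrable_entry_mul i j f] with x hx
      simp_rw [← huv, hI, mul_assoc]
      exact hx.const_mul _)
    (fun f => by
      have h := ((Lp.memLp (R (L2Vec.ofCoord j f))).eval_piLp i).const_mul (-Complex.I)
      refine (memLp_congr_ae ?_).1 h
      filter_upwards [hR.apply_ofCoord i j f] with x hx
      simp_rw [← huv, hI, mul_assoc]
      rw [integral_const_mul, hx])
  choose a ham haL ha0 haz using fun k => exists_measurable_zero_extension (hz.eval_piLp k)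
  choose b hbm hbL hb0 hbw using fun k => exists_measurable_zero_extension (hw.eval_piLp k).star
  refine ⟨a, b, fun k => ⟨ham k, haL k, ha0 k⟩, fun k => ⟨hbm k, hbL k, hb0 k⟩,
    _, Filter.inter_mem hS (ae_all_iff.2 haz), _, Filter.inter_mem hS' (ae_all_iff.2 hbw), ?_⟩
  rintro x ⟨hx, hxa⟩ t ⟨ht, htb⟩
  rw [huv, hSS x hx t ht, PiLp.inner_apply]
  refine Finset.sum_congr rfl fun k _ => ?_
  rw [← show z x k = a k x from hxa k, ← show star (w t k) = b k t from htb k, RCLike.inner_apply]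
  rfl

/-! ### Step and ramp functions -/

/-- The element `1_{(t, ∞)}` of `L²(0, l)`. -/
noncomputable def stepL2 (l t : ℝ) : Lp ℂ 2 (intervalMeasure l) :=
  indicatorConstLp 2 (measurableSet_Ioi (a := t)) (measure_ne_top _ _) 1

theorem coeFn_stepL2 (l t : ℝ) :
    stepL2 l t =ᵐ[intervalMeasure l] (Ioi t).indicator fun _ => (1 : ℂ) :=
  indicatorConstLp_coeFn

theorem memLp_ramp (l t : ℝ) :
    MemLp (fun s : ℝ => ((max (s - t) 0 : ℝ) : ℂ)) 2 (intervalMeasure l) := by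
  have hc : Continuous fun s : ℝ => ((max (s - t) 0 : ℝ) : ℂ) := by fun_prop
  refine MemLp.of_bound (C := |l| + |t|) hc.aestronglyMeasurable ?_
  filter_upwards [ae_restrict_mem measurableSet_Ioo] with s hs
  rw [Complex.norm_real, Real.norm_eq_abs, abs_of_nonneg (le_max_right _ _)]
  refine max_le ?_ (by positivity)
  linarith [hs.2, le_abs_self l, neg_abs_le t]

/-- The element `s ↦ (s - t)⁺` of `L²(0, l)`. -/
noncomputable def rampL2 (l t : ℝ) : Lp ℂ 2 (intervalMeasure l) := (memLp_ramp l t).toLp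

theorem coeFn_rampL2 (l t : ℝ) :
    rampL2 l t =ᵐ[intervalMeasure l] fun s => ((max (s - t) 0 : ℝ) : ℂ) :=
  (memLp_ramp l t).coeFn_toLp

/-- This is the terminal condition for integration along characteristics. -/
theorem rampL2_eq_zero {l t : ℝ} (h : l ≤ t) : rampL2 l t = 0 := by
  rw [Lp.eq_zero_iff_ae_eq_zero]
  filter_upwards [coeFn_rampL2 l t, ae_restrict_mem measurableSet_Ioo] with s hs hs'
  rw [hs, max_eq_right (by linarith [hs'.2])]
  simp

/-- The first-order remainder vanishes unless `|s - t| ≤ |y - t|` and is at most `|y - t|` there.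
The indicator of that interval has `L²` norm at most `√(2|y - t|)`, so the remainder is `o(|y - t|)`
in spite of the kink of the ramp. -/
theorem norm_rampL2_sub_le (l t y : ℝ) :
    ‖rampL2 l y - rampL2 l t - (y - t) • -stepL2 l t‖ ≤ √(2 * |y - t|) * ‖y - t‖ := by
  let N := indicatorConstLp (μ := intervalMeasure l) 2
    (measurableSet_Icc (a := t - |y - t|) (b := t + |y - t|)) (measure_ne_top _ _) (1 : ℂ)
  have h1 : ‖N‖ ≤ √(2 * |y - t|) := by
    refine norm_indicatorConstLp_le.trans ?_
    rw [norm_one, one_mul, Real.sqrt_eq_rpow]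
    rw [ENNReal.toReal_ofNat]
    refine Real.rpow_le_rpow measureReal_nonneg ?_ (by norm_num)
    have h2 : (intervalMeasure l).real (Icc (t - |y - t|) (t + |y - t|)) ≤
        volume.real (Icc (t - |y - t|) (t + |y - t|)) :=
      ENNReal.toReal_mono measure_Icc_lt_top.ne (Measure.restrict_apply_le _ _)
    refine h2.trans ?_
    rw [Real.volume_real_Icc]
    refine max_le (by linarith) (by positivity)
  rw [mul_comm]
  refine le_trans ?_ (mul_le_mul_of_nonneg_left h1 (norm_nonneg _))
  refine Lp.norm_le_mul_norm_of_ae_le_mul ?_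
  filter_upwards [coeFn_rampL2 l y, coeFn_rampL2 l t, coeFn_stepL2 l t,
    Lp.coeFn_sub (rampL2 l y - rampL2 l t) ((y - t) • -stepL2 l t),
    Lp.coeFn_sub (rampL2 l y) (rampL2 l t), Lp.coeFn_smul (y - t) (-stepL2 l t),
    Lp.coeFn_neg (stepL2 l t), indicatorConstLp_coeFn (μ := intervalMeasure l) (p := 2)
    (hs := measurableSet_Icc (a := t - |y - t|) (b := t + |y - t|)) (hμs := measure_ne_top _ _)
    (c := (1 : ℂ))] with s h1 h2 h3 h4 h5 h6 h7 h8
  rw [h4, Pi.sub_apply, h5, Pi.sub_apply, h6, Pi.smul_apply, h7, Pi.neg_apply, h1, h2, h3, h8]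
  have hstep : (Ioi t).indicator (fun _ => (1 : ℂ)) s = ((if t < s then 1 else 0 : ℝ) : ℂ) := by
    by_cases h : t < s <;> simp [h]
  rw [hstep, Complex.real_smul, ← Complex.ofReal_neg, ← Complex.ofReal_mul, ← Complex.ofReal_sub,
    ← Complex.ofReal_sub, Complex.norm_real]
  by_cases hs : s ∈ Icc (t - |y - t|) (t + |y - t|)
  · rw [indicator_of_mem hs, norm_one, mul_one, Real.norm_eq_abs, Real.norm_eq_abs]
    split_ifs with hts
    · rw [max_eq_left (a := s - t) (by linarith)]
      rcases max_cases (s - y) 0 with h | h <;> rw [h.1, abs_le] <;>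
        constructor <;> linarith [le_abs_self (y - t), neg_abs_le (y - t), h.2]
    · rw [max_eq_right (a := s - t) (by linarith)]
      rcases max_cases (s - y) 0 with h | h <;> rw [h.1, abs_le] <;>
        constructor <;> linarith [le_abs_self (y - t), neg_abs_le (y - t), h.2]
  · rw [indicator_of_notMem hs, norm_zero, mul_zero, norm_le_zero_iff]
    rcases lt_or_ge s (t - |y - t|) with h | h
    · have h1 : s < t := by linarith [abs_nonneg (y - t)]
      rw [if_neg h1.le.not_gt, max_eq_right (by linarith [neg_abs_le (y - t)]),
        max_eq_right (by linarith)]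
      ring
    · have h1 : t + |y - t| < s := by
        by_contra h2
        exact hs ⟨h, not_lt.1 h2⟩
      have h2 : t < s := by linarith [abs_nonneg (y - t)]
      rw [if_pos h2, max_eq_left (by linarith [le_abs_self (y - t)]), max_eq_left (by linarith)]
      ring

theorem hasDerivAt_rampL2 (l t : ℝ) : HasDerivAt (rampL2 l) (-stepL2 l t) t := by
  rw [hasDerivAt_iff_isLittleO, Asymptotics.isLittleO_iff]
  intro c hc
  have h : Filter.Tendsto (fun y => √(2 * |y - t|)) (nhds t) (nhds 0) := by
    have : Continuous fun y => √(2 * |y - t|) := by fun_prop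
    simpa using this.tendsto t
  filter_upwards [h.eventually_le_const hc] with y hy
  exact (norm_rampL2_sub_le l t y).trans (mul_le_mul_of_nonneg_right hy (norm_nonneg _))

/-- The element `1_{(t, ∞)} e_j` of `L²_p(0, l)`. -/
noncomputable def stepVec {p : ℕ} (l : ℝ) (j : Fin p) (t : ℝ) : L2Vec p l :=
  L2Vec.ofCoord j (stepL2 l t)

/-- The element `s ↦ (s - t)⁺ e_j` of `L²_p(0, l)`. -/
noncomputable def rampVec {p : ℕ} (l : ℝ) (j : Fin p) (t : ℝ) : L2Vec p l :=
  L2Vec.ofCoord j (rampL2 l t)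

theorem coeFn_stepVec {p : ℕ} (l : ℝ) (j : Fin p) (t : ℝ) :
    stepVec l j t =ᵐ[intervalMeasure l]
      (Ioi t).indicator fun _ => EuclideanSpace.single j (1 : ℂ) := by
  filter_upwards [L2Vec.coeFn_ofCoord j (stepL2 l t), coeFn_stepL2 l t] with s h1 h2
  rw [stepVec, h1, h2]
  by_cases h : s ∈ Ioi t <;> simp [h]

theorem coeFn_rampVec {p : ℕ} (l : ℝ) (j : Fin p) (t : ℝ) :
    rampVec l j t =ᵐ[intervalMeasure l]
      fun s => ((max (s - t) 0 : ℝ) : ℂ) • EuclideanSpace.single j (1 : ℂ) := by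
  filter_upwards [L2Vec.coeFn_ofCoord j (rampL2 l t), coeFn_rampL2 l t] with s h1 h2
  rw [rampVec, h1, h2]

theorem hasDerivAt_rampVec {p : ℕ} (l : ℝ) (j : Fin p) (t : ℝ) :
    HasDerivAt (rampVec l j) (-stepVec l j t) t := by
  have h := ((L2Vec.ofCoord j).restrictScalars ℝ).hasFDerivAt.comp_hasDerivAt t
    (hasDerivAt_rampL2 l t)
  simpa using! h

theorem rampVec_eq_zero {p : ℕ} {l t : ℝ} (j : Fin p) (h : l ≤ t) : rampVec l j t = 0 := by
  rw [rampVec, rampL2_eq_zero h, map_zero]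

theorem inner_stepVec {p : ℕ} {l : ℝ} (i : Fin p) (x : ℝ) (g : L2Vec p l) :
    inner ℂ (stepVec l i x) g = ∫ s in Ioi x, g s i ∂(intervalMeasure l) := by
  rw [L2.inner_def, ← integral_indicator measurableSet_Ioi]
  refine integral_congr_ae ?_
  filter_upwards [coeFn_stepVec l i x] with s hs
  rw [hs]
  by_cases h : s ∈ Ioi x <;> simp [h, EuclideanSpace.inner_single_left]

/-- The condition `0 ≤ t` matters: the integral in `A` starts at `0`, so for negative `t` it would
give `x` instead of `x - t`. -/
theorem opA_stepVec {p : ℕ} (d : Fin p → ℝ) (l : ℝ) (j : Fin p) {t : ℝ} (ht : 0 ≤ t) :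
    opA d l (stepVec l j t) = (Complex.I * d j) • rampVec l j t := by
  refine Lp.ext ?_
  have hst := (ae_restrict_iff' measurableSet_Ioo).1 (coeFn_stepVec l j t)
  filter_upwards [opA_apply d l (stepVec l j t), coeFn_rampVec l j t,
    Lp.coeFn_smul (Complex.I * d j) (rampVec l j t), ae_restrict_mem measurableSet_Ioo]
    with x h1 h2 h3 hx
  have h4 : ∫ s in (0 : ℝ)..x, stepVec l j t s =
      ((max (x - t) 0 : ℝ) : ℂ) • EuclideanSpace.single j (1 : ℂ) := by
    have h5 : ∫ s in (0 : ℝ)..x, stepVec l j t s =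
        ∫ s in (0 : ℝ)..x, (Ioi t).indicator (fun _ => EuclideanSpace.single j (1 : ℂ)) s := by
      refine intervalIntegral.integral_congr_ae ?_
      filter_upwards [hst] with s hs hmem
      rw [uIoc_of_le hx.1.le] at hmem
      exact hs ⟨hmem.1, hmem.2.trans_lt hx.2⟩
    have h6 : Ioc 0 x ∩ Ioi t = Ioc t x := by
      ext s
      simp only [mem_inter_iff, mem_Ioc, mem_Ioi]
      exact ⟨fun h => ⟨h.2, h.1.2⟩, fun h => ⟨⟨ht.trans_lt h.1, h.2⟩, h.1⟩⟩
    rw [h5, intervalIntegral.integral_of_le hx.1.le, setIntegral_indicator measurableSet_Ioi, h6,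
      setIntegral_const, Real.volume_real_Ioc, Complex.coe_smul]
  rw [h1, h3, Pi.smul_apply, h2, h4]
  ext k
  rw [PiLp.smul_apply, PiLp.smul_apply, toEuclideanLin_smul_single, matD]
  by_cases hk : k = j
  · subst hk
    simp [mul_assoc]
  · simp [hk]

/-! ### The transport equation and its solution -/

theorem setIntegral_intervalMeasure_eq {l : ℝ} {a : ℝ → ℂ} (ha : ∀ x ∉ Ioo 0 l, a x = 0)
    {s : Set ℝ} (hs : MeasurableSet s) : ∫ x in s, a x ∂(intervalMeasure l) = ∫ x in s, a x := by
  rw [Measure.restrict_restrict hs]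
  refine (setIntegral_eq_of_subset_of_forall_sdiff_eq_zero hs inter_subset_left ?_).symm
  rintro x ⟨hx, hx'⟩
  exact ha x fun h => hx' ⟨hx, h⟩

theorem MemLp.integrable_of_zero_off_Ioo {l : ℝ} {a : ℝ → ℂ} (ha : MemLp a 2 volume)
    (h0 : ∀ x ∉ Ioo 0 l, a x = 0) : Integrable a := by
  have h1 : IntegrableOn a (Ioo 0 l) := (ha.restrict (Ioo 0 l)).integrable (by norm_num)
  exact h1.integrable_of_forall_notMem_eq_zero h0

/-- The operator identity `TA - A*T = i ∫ Q(x, t) · dt` tested on step functions. -/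
theorem inner_ramp_step_identity {p q : ℕ} {d : Fin p → ℝ} {l : ℝ}
    {Q : ℝ → ℝ → Matrix (Fin p) (Fin p) ℂ} {T : L2Vec p l →L[ℂ] L2Vec p l}
    (hT : IsIntegralOperator
      (T.comp (opA d l) - (ContinuousLinearMap.adjoint (opA d l)).comp T)
      (fun x t => Complex.I • Q x t)) {i j : Fin p} {a b : Fin q → ℝ → ℂ}
    (ha : ∀ k, MemLp (a k) 2 volume ∧ ∀ x ∉ Ioo 0 l, a k x = 0)
    (hb : ∀ k, MemLp (b k) 2 volume ∧ ∀ x ∉ Ioo 0 l, b k x = 0) {S S' : Set ℝ}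
    (hS : S ∈ ae (intervalMeasure l)) (hS' : S' ∈ ae (intervalMeasure l))
    (hQ : ∀ x ∈ S, ∀ t ∈ S', Q x t i j = ∑ k, a k x * b k t) {x t : ℝ} (hx : 0 ≤ x)
    (ht : 0 ≤ t) :
    d j * inner ℂ (stepVec l i x) (T (rampVec l j t)) +
      d i * inner ℂ (rampVec l i x) (T (stepVec l j t)) =
    ∑ k, (∫ s in Ioi x, a k s) * ∫ s in Ioi t, b k s := by
  have h1 : inner ℂ (stepVec l i x)
      ((T.comp (opA d l) - (ContinuousLinearMap.adjoint (opA d l)).comp T) (stepVec l j t)) =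
      Complex.I * (d j * inner ℂ (stepVec l i x) (T (rampVec l j t)) +
      d i * inner ℂ (rampVec l i x) (T (stepVec l j t))) := by
    -- Moving `A*` to the left slot conjugates `i d_i`, which turns the difference into a sum.
    rw [sub_apply, ContinuousLinearMap.comp_apply,
      ContinuousLinearMap.comp_apply, inner_sub_right, ContinuousLinearMap.adjoint_inner_right,
      opA_stepVec d l j ht, opA_stepVec d l i hx, map_smul, inner_smul_right, inner_smul_left]
    simp only [map_mul, Complex.conj_I, Complex.conj_ofReal]
    ring
  have hbi : ∀ k, Integrable (b k) := fun k => MemLp.integrable_of_zero_off_Ioo (hb k).1 (hb k).2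
  have hai : ∀ k, Integrable (a k) := fun k => MemLp.integrable_of_zero_off_Ioo (ha k).1 (ha k).2
  have h2 : (fun y => (T.comp (opA d l) - (ContinuousLinearMap.adjoint (opA d l)).comp T)
      (stepVec l j t) y i) =ᵐ[intervalMeasure l]
      fun y => Complex.I * ∑ k, a k y * ∫ s in Ioi t, b k s := by
    filter_upwards [hT.apply_ofCoord i j (stepL2 l t), hS] with y hy hyS
    rw [stepVec, hy]
    have h3 : ∫ s, (Complex.I • Q y s) i j * stepL2 l t s ∂(intervalMeasure l) =
        ∫ s, (Ioi t).indicator (fun s => Complex.I * ∑ k, a k y * b k s) s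
          ∂(intervalMeasure l) := by
      refine integral_congr_ae ?_
      filter_upwards [hS', coeFn_stepL2 l t] with s hs hs'
      rw [hs', Matrix.smul_apply, hQ y hyS s hs]
      by_cases h : s ∈ Ioi t <;> simp [h]
    rw [h3, integral_indicator measurableSet_Ioi, integral_const_mul, integral_finsetSum]
    · simp_rw [integral_const_mul, setIntegral_intervalMeasure_eq (hb _).2 measurableSet_Ioi]
    · exact fun k _ => ((hbi k).restrict.restrict).const_mul _
  have h4 : inner ℂ (stepVec l i x)
      ((T.comp (opA d l) - (ContinuousLinearMap.adjoint (opA d l)).comp T) (stepVec l j t)) =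
      Complex.I * ∑ k, (∫ s in Ioi x, a k s) * ∫ s in Ioi t, b k s := by
    rw [inner_stepVec, integral_congr_ae (ae_restrict_of_ae h2), integral_const_mul,
      integral_finsetSum]
    · simp_rw [integral_mul_const, setIntegral_intervalMeasure_eq (ha _).2 measurableSet_Ioi]
    · exact fun k _ => ((hai k).restrict.restrict).mul_const _
  exact mul_left_cancel₀ Complex.I_ne_zero (h1.symm.trans h4)

/-- The identities to be differentiated hold only on `[0, ∞)`; at the endpoint `0` the one-sided
derivative must suffice. -/
theorem HasDerivAt.unique_of_eqOn_Ici {E : Type*} [NormedAddCommGroup E] [NormedSpace ℝ E]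
    {f g : ℝ → E} {f' g' : E} {c x : ℝ} (hf : HasDerivAt f f' x) (hg : HasDerivAt g g' x)
    (h : ∀ y, c ≤ y → f y = g y) (hx : c ≤ x) : f' = g' :=
  (uniqueDiffOn_Ici c x hx).eq_deriv _ hf.hasDerivWithinAt
    (hg.hasDerivWithinAt.congr (fun y hy => h y hy) (h x hx))

/-- With `c = d_j` and `e = d_i` the derivative is minus the left side of
`inner_ramp_step_identity`; this choice of direction makes the line a characteristic. -/
theorem hasDerivAt_inner_rampVec {p : ℕ} {l : ℝ} (T : L2Vec p l →L[ℂ] L2Vec p l) (i j : Fin p)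
    (x t c e w : ℝ) :
    HasDerivAt (fun w => inner ℂ (rampVec l i (x + c * w)) (T (rampVec l j (t + e * w))))
      (-(c * inner ℂ (stepVec l i (x + c * w)) (T (rampVec l j (t + e * w))) +
        e * inner ℂ (rampVec l i (x + c * w)) (T (stepVec l j (t + e * w))))) w := by
  have hlin : ∀ x c : ℝ, HasDerivAt (fun w => x + c * w) c w := fun x c => by
    simpa using ((hasDerivAt_id w).const_mul c).const_add x
  have h1 := (hasDerivAt_rampVec l i (x + c * w)).scomp w (hlin x c)
  have h2 := (hasDerivAt_rampVec l j (t + e * w)).scomp w (hlin t e)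
  have h3 := (T.restrictScalars ℝ).hasFDerivAt.comp_hasDerivAt w h2
  have h4 := h1.inner ℂ h3
  refine h4.congr_deriv ?_
  simp only [Function.comp_apply, ContinuousLinearMap.coe_restrictScalars', map_smul, map_neg,
    smul_neg, inner_neg_left, inner_neg_right]
  rw [← algebraMap_smul ℂ c (stepVec l i (x + c * w)),
    ← algebraMap_smul ℂ e (T (stepVec l j (t + e * w))), inner_smul_left, inner_smul_right,
    Complex.coe_algebraMap, Complex.conj_ofReal]
  ring

section Transport

variable {p q : ℕ} {d : Fin p → ℝ} {l : ℝ} {T : L2Vec p l →L[ℂ] L2Vec p l} {i j : Fin p}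
  {a b : Fin q → ℝ → ℂ}

theorem inner_rampVec_eq_sum_integral (hd : ∀ i, 0 < d i) (hl : 0 < l)
    (ha : ∀ k, MemLp (a k) 2 volume ∧ ∀ x ∉ Ioo 0 l, a k x = 0)
    (hb : ∀ k, MemLp (b k) 2 volume ∧ ∀ x ∉ Ioo 0 l, b k x = 0)
    (h : ∀ x t : ℝ, 0 ≤ x → 0 ≤ t → d j * inner ℂ (stepVec l i x) (T (rampVec l j t)) +
      d i * inner ℂ (rampVec l i x) (T (stepVec l j t)) =
      ∑ k, (∫ s in Ioi x, a k s) * ∫ s in Ioi t, b k s) {x t : ℝ} (hx : 0 ≤ x) (ht : 0 ≤ t) :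
    inner ℂ (rampVec l i x) (T (rampVec l j t)) =
      ∑ k, ∫ w, (∫ s in Ioi (x + d j * w), a k s) *
        (Ioc 0 (l / d j)).indicator (fun w => ∫ s in Ioi (t + d i * w), b k s) w := by
  have hW : 0 ≤ l / d j := (div_pos hl (hd j)).le
  have hα : ∀ k, Continuous fun w => ∫ s in Ioi (x + d j * w), a k s := fun k =>
    (continuous_integral_Ioi (MemLp.integrable_of_zero_off_Ioo (ha k).1 (ha k).2)).comp
      (by fun_prop : Continuous fun w => x + d j * w)
  have hβ : ∀ k, Continuous fun w => ∫ s in Ioi (t + d i * w), b k s := fun k =>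
    (continuous_integral_Ioi (MemLp.integrable_of_zero_off_Ioo (hb k).1 (hb k).2)).comp
      (by fun_prop : Continuous fun w => t + d i * w)
  have hc : ∀ k, Continuous fun w => (∫ s in Ioi (x + d j * w), a k s) *
      ∫ s in Ioi (t + d i * w), b k s := fun k => (hα k).mul (hβ k)
  have h1 : ∀ w ∈ uIcc 0 (l / d j),
      HasDerivAt (fun w => inner ℂ (rampVec l i (x + d j * w)) (T (rampVec l j (t + d i * w))))
        (-∑ k, (∫ s in Ioi (x + d j * w), a k s) * ∫ s in Ioi (t + d i * w), b k s) w := by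
    intro w hw
    rw [uIcc_of_le hW] at hw
    rw [← h _ _ (add_nonneg hx (mul_nonneg (hd j).le hw.1))
      (add_nonneg ht (mul_nonneg (hd i).le hw.1))]
    exact hasDerivAt_inner_rampVec T i j x t (d j) (d i) w
  have h2 := intervalIntegral.integral_eq_sub_of_hasDerivAt h1
    ((continuous_finsetSum _ fun k _ => hc k).neg.intervalIntegrable _ _)
  -- At `w = l / d_j` the first coordinate is at least `l`, so the boundary term there vanishes.
  rw [rampVec_eq_zero (t := x + d j * (l / d j)) i
    (by rw [mul_div_cancel₀ _ (hd j).ne']; linarith), inner_zero_left, zero_sub,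
    intervalIntegral.integral_neg, neg_inj, intervalIntegral.integral_finsetSum
      fun k _ => (hc k).intervalIntegrable _ _] at h2
  simp only [mul_zero, add_zero] at h2
  rw [← h2]
  refine Finset.sum_congr rfl fun k _ => ?_
  rw [intervalIntegral.integral_of_le hW, ← integral_indicator measurableSet_Ioc]
  simp_rw [indicator_mul_right]

theorem memLp_indicator_Ioc_of_continuous {f : ℝ → ℂ} (hf : Continuous f) (W : ℝ) (r : ENNReal) :
    MemLp ((Ioc 0 W).indicator f) r volume := by
  rw [memLp_indicator_iff_restrict measurableSet_Ioc]
  obtain ⟨C, hC⟩ := (isCompact_Icc (a := 0) (b := W)).exists_bound_of_continuousOn hf.continuousOn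
  refine MemLp.of_bound hf.aestronglyMeasurable C ?_
  filter_upwards [ae_restrict_mem measurableSet_Ioc] with w hw
  exact hC w (Ioc_subset_Icc_self hw)

/-- Each differentiation turns one tail integral into its integrand by
`hasDerivAt_integral_tail_translate_mul`. The factor not being differentiated carries the cut-off to
`(0, l / d_j]`, so the indicator changes sides between the `x`-derivative and the `t`-derivative. -/
theorem inner_stepVec_eq_sum_integral (hd : ∀ i, 0 < d i) (hl : 0 < l)
    (ha : ∀ k, Measurable (a k) ∧ MemLp (a k) 2 volume ∧ ∀ x ∉ Ioo 0 l, a k x = 0)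
    (hb : ∀ k, Measurable (b k) ∧ MemLp (b k) 2 volume ∧ ∀ x ∉ Ioo 0 l, b k x = 0)
    (h : ∀ x t : ℝ, 0 ≤ x → 0 ≤ t → d j * inner ℂ (stepVec l i x) (T (rampVec l j t)) +
      d i * inner ℂ (rampVec l i x) (T (stepVec l j t)) =
      ∑ k, (∫ s in Ioi x, a k s) * ∫ s in Ioi t, b k s) {x t : ℝ} (hx : 0 ≤ x) (ht : 0 ≤ t) :
    inner ℂ (stepVec l i x) (T (stepVec l j t)) =
      ∑ k, ∫ w in Ioc 0 (l / d j), a k (x + d j * w) * b k (t + d i * w) := by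
  have hai : ∀ k, Integrable (a k) := fun k =>
    MemLp.integrable_of_zero_off_Ioo (ha k).2.1 (ha k).2.2
  have hbi : ∀ k, Integrable (b k) := fun k =>
    MemLp.integrable_of_zero_off_Ioo (hb k).2.1 (hb k).2.2
  have h1 : ∀ t, 0 ≤ t → inner ℂ (stepVec l i x) (T (rampVec l j t)) =
      ∑ k, ∫ w, (∫ s in Ioi (t + d i * w), b k s) *
        (Ioc 0 (l / d j)).indicator (fun w => a k (x + d j * w)) w := by
    intro t ht
    have hβ : ∀ k, Continuous fun w => ∫ s in Ioi (t + d i * w), b k s := fun k =>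
      (continuous_integral_Ioi (hbi k)).comp (by fun_prop : Continuous fun w => t + d i * w)
    have hL : HasDerivAt (fun x => inner ℂ (rampVec l i x) (T (rampVec l j t)))
        (-inner ℂ (stepVec l i x) (T (rampVec l j t))) x := by
      simpa using (hasDerivAt_rampVec l i x).inner ℂ (hasDerivAt_const x (T (rampVec l j t)))
    have hR := HasDerivAt.fun_sum (u := Finset.univ) fun k _ =>
      hasDerivAt_integral_tail_translate_mul (ha k).2.1 (hai k) (ha k).1
        (memLp_indicator_Ioc_of_continuous (hβ k) (l / d j) 2)
        (memLp_one_iff_integrable.1 (memLp_indicator_Ioc_of_continuous (hβ k) (l / d j) 1))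
        (hd j).ne' x
    have hu := hL.unique_of_eqOn_Ici hR (fun y hy => inner_rampVec_eq_sum_integral hd hl
      (fun k => (ha k).2) (fun k => (hb k).2) h hy ht) hx
    rw [Finset.sum_neg_distrib, neg_inj] at hu
    rw [hu]
    refine Finset.sum_congr rfl fun k _ => integral_congr_ae (Filter.Eventually.of_forall ?_)
    intro w
    by_cases hw : w ∈ Ioc 0 (l / d j) <;> simp [hw, mul_comm]
  have hL : HasDerivAt (fun t => inner ℂ (stepVec l i x) (T (rampVec l j t)))
      (-inner ℂ (stepVec l i x) (T (stepVec l j t))) t := by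
    have h3 := (T.restrictScalars ℝ).hasFDerivAt.comp_hasDerivAt t (hasDerivAt_rampVec l j t)
    simpa using (hasDerivAt_const t (stepVec l i x)).inner ℂ h3
  have hag : ∀ k, MemLp ((Ioc 0 (l / d j)).indicator fun w => a k (x + d j * w)) 2 volume :=
    fun k => (MemLp.comp_mul_add (ha k).2.1 (ha k).1 (hd j).ne' x).indicator measurableSet_Ioc
  have hag1 : ∀ k, Integrable ((Ioc 0 (l / d j)).indicator fun w => a k (x + d j * w)) :=
    fun k => (((hai k).comp_add_left x).comp_mul_left' (hd j).ne').indicator measurableSet_Ioc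
  have hR := HasDerivAt.fun_sum (u := Finset.univ) fun k _ =>
    hasDerivAt_integral_tail_translate_mul (hb k).2.1 (hbi k) (hb k).1 (hag k) (hag1 k)
      (hd i).ne' t
  have hu := hL.unique_of_eqOn_Ici hR h1 ht
  rw [Finset.sum_neg_distrib, neg_inj] at hu
  rw [hu]
  refine Finset.sum_congr rfl fun k _ => ?_
  rw [← integral_indicator measurableSet_Ioc]
  refine integral_congr_ae (Filter.Eventually.of_forall fun w => ?_)
  by_cases hw : w ∈ Ioc 0 (l / d j) <;> simp [hw, mul_comm]

end Transport

/-! ### `Υ` as an integral along characteristics -/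

theorem ae_comp_add_mul {P : ℝ → Prop} (h : ∀ᵐ y, P y) (x : ℝ) {c : ℝ} (hc : c ≠ 0) :
    ∀ᵐ w, P (x + c * w) := by
  rw [ae_iff] at h ⊢
  have h1 : {w | ¬P (x + c * w)} = (fun w => c * w) ⁻¹' ((fun y => x + y) ⁻¹' {y | ¬P y}) := rfl
  rw [h1, Real.volume_preimage_mul_left hc, measure_preimage_add, h, mul_zero]

/-- In the parameter `w` with `u = d_i x + d_j t + 2 d_i d_j w`, the limit `fMin` is where the
characteristic through `(x, t)` leaves the square. -/
theorem fMin_eq {p : ℕ} {d : Fin p → ℝ} (hd : ∀ i, 0 < d i) (l : ℝ) (i j : Fin p) (x t : ℝ) :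
    fMin d l i j x t = d i * x + d j * t +
      2 * d i * d j * min ((l - x) / d j) ((l - t) / d i) := by
  have hi := hd i
  have hj := hd j
  rw [fMin, mul_min_of_nonneg _ _ (by positivity), ← min_add_add_left]
  congr 1 <;> field_simp <;> ring

theorem upsilonIntegrand_add_mul {p : ℕ} {d : Fin p → ℝ} (hd : ∀ i, 0 < d i)
    (Q : ℝ → ℝ → Matrix (Fin p) (Fin p) ℂ) (i j : Fin p) (x t w : ℝ) :
    upsilonIntegrand d Q i j x t (d i * x + d j * t + 2 * d i * d j * w) =
      Q (x + d j * w) (t + d i * w) i j := by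
  have hi := hd i
  have hj := hd j
  rw [upsilonIntegrand]
  congr 2 <;> field_simp <;> ring

section Upsilon

variable {p q : ℕ} {d : Fin p → ℝ} {l : ℝ} {Q : ℝ → ℝ → Matrix (Fin p) (Fin p) ℂ} {i j : Fin p}
  {a b : Fin q → ℝ → ℂ}

/-- Along almost all of a characteristic segment the kernel agrees with its regular
representative. -/
theorem ae_upsilonIntegrand_eq_sum (hd : ∀ i, 0 < d i) {S S' : Set ℝ}
    (hS : S ∈ ae (intervalMeasure l)) (hS' : S' ∈ ae (intervalMeasure l))
    (hQ : ∀ x ∈ S, ∀ t ∈ S', Q x t i j = ∑ k, a k x * b k t) {x t : ℝ} (hx : 0 ≤ x)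
    (ht : 0 ≤ t) :
    ∀ᵐ w, w ∈ Ioo 0 (min ((l - x) / d j) ((l - t) / d i)) →
      upsilonIntegrand d Q i j x t (d i * x + d j * t + 2 * d i * d j * w) =
        ∑ k, a k (x + d j * w) * b k (t + d i * w) := by
  filter_upwards [ae_comp_add_mul ((ae_restrict_iff' measurableSet_Ioo).1 hS) x (hd j).ne',
    ae_comp_add_mul ((ae_restrict_iff' measurableSet_Ioo).1 hS') t (hd i).ne'] with w h1 h2 hw
  rw [upsilonIntegrand_add_mul hd]
  have h3 := (lt_div_iff₀ (hd j)).1 (lt_min_iff.1 hw.2).1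
  have h4 := (lt_div_iff₀ (hd i)).1 (lt_min_iff.1 hw.2).2
  have h5 := mul_pos (hd j) hw.1
  have h6 := mul_pos (hd i) hw.1
  exact hQ _ (h1 ⟨by linarith, by linarith⟩) _ (h2 ⟨by linarith, by linarith⟩)

theorem integrable_sum_line (hd : ∀ i, 0 < d i)
    (ha : ∀ k, Measurable (a k) ∧ MemLp (a k) 2 volume ∧ ∀ x ∉ Ioo 0 l, a k x = 0)
    (hb : ∀ k, Measurable (b k) ∧ MemLp (b k) 2 volume ∧ ∀ x ∉ Ioo 0 l, b k x = 0) (x t : ℝ)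
    (k : Fin q) : Integrable fun w => a k (x + d j * w) * b k (t + d i * w) :=
  (MemLp.comp_mul_add (ha k).2.1 (ha k).1 (hd j).ne' x).integrable_mul
    (MemLp.comp_mul_add (hb k).2.1 (hb k).1 (hd i).ne' t)

theorem intervalIntegrable_upsilonIntegrand (hd : ∀ i, 0 < d i)
    (ha : ∀ k, Measurable (a k) ∧ MemLp (a k) 2 volume ∧ ∀ x ∉ Ioo 0 l, a k x = 0)
    (hb : ∀ k, Measurable (b k) ∧ MemLp (b k) 2 volume ∧ ∀ x ∉ Ioo 0 l, b k x = 0) {S S' : Set ℝ}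
    (hS : S ∈ ae (intervalMeasure l)) (hS' : S' ∈ ae (intervalMeasure l))
    (hQ : ∀ x ∈ S, ∀ t ∈ S', Q x t i j = ∑ k, a k x * b k t) {x t : ℝ} (hx : x ∈ Icc 0 l)
    (ht : t ∈ Icc 0 l) :
    IntervalIntegrable (upsilonIntegrand d Q i j x t) volume (d i * x + d j * t)
      (fMin d l i j x t) := by
  have hc : 2 * d i * d j ≠ 0 := by
    have hi := hd i
    have hj := hd j
    positivity
  set m := min ((l - x) / d j) ((l - t) / d i) with hm
  have hm0 : 0 ≤ m := le_min (div_nonneg (by linarith [hx.2]) (hd j).le)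
    (div_nonneg (by linarith [ht.2]) (hd i).le)
  have h1 : IntervalIntegrable (fun w => upsilonIntegrand d Q i j x t
      (d i * x + d j * t + 2 * d i * d j * w)) volume 0 m := by
    rw [intervalIntegrable_iff_integrableOn_Ioo_of_le hm0]
    refine ((integrable_finsetSum Finset.univ fun k _ =>
      integrable_sum_line (i := i) (j := j) hd ha hb x t k).integrableOn (s := Ioo 0 m)).congr ?_
    filter_upwards [ae_restrict_of_ae (ae_upsilonIntegrand_eq_sum hd hS hS' hQ hx.1 ht.1),
      ae_restrict_mem measurableSet_Ioo] with w hw hw'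
    exact (hw hw').symm
  have h2 : IntervalIntegrable (fun y => upsilonIntegrand d Q i j x t (d i * x + d j * t + y))
      volume 0 (2 * d i * d j * m) := by
    rw [← IntervalIntegrable.comp_mul_left_iff hc, zero_div, mul_div_cancel_left₀ _ hc]
    exact h1
  rw [fMin_eq hd, ← hm, ← IntervalIntegrable.comp_add_left_iff (c := d i * x + d j * t), sub_self,
    add_sub_cancel_left]
  exact h2

/-- The exit time `m` may be replaced by `l / d_j`, which does not depend on `x` and `t`: past `m`
one argument is at least `l` and the corresponding factor is zero. -/
theorem upsilon_eq_sum_integral (hd : ∀ i, 0 < d i)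
    (ha : ∀ k, Measurable (a k) ∧ MemLp (a k) 2 volume ∧ ∀ x ∉ Ioo 0 l, a k x = 0)
    (hb : ∀ k, Measurable (b k) ∧ MemLp (b k) 2 volume ∧ ∀ x ∉ Ioo 0 l, b k x = 0) {S S' : Set ℝ}
    (hS : S ∈ ae (intervalMeasure l)) (hS' : S' ∈ ae (intervalMeasure l))
    (hQ : ∀ x ∈ S, ∀ t ∈ S', Q x t i j = ∑ k, a k x * b k t) {x t : ℝ} (hx : x ∈ Icc 0 l)
    (ht : t ∈ Icc 0 l) :
    upsilon d l Q x t i j =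
      ∑ k, ∫ w in Ioc 0 (l / d j), a k (x + d j * w) * b k (t + d i * w) := by
  have hi := hd i
  have hj := hd j
  have hc : 2 * d i * d j ≠ 0 := by positivity
  set m := min ((l - x) / d j) ((l - t) / d i) with hm
  have hm0 : 0 ≤ m := le_min (div_nonneg (by linarith [hx.2]) hj.le)
    (div_nonneg (by linarith [ht.2]) hi.le)
  have hml : m ≤ l / d j := (min_le_left _ _).trans
    (div_le_div_of_nonneg_right (by linarith [hx.1]) hj.le)
  have h1 : upsilon d l Q x t i j = ∫ w in (0 : ℝ)..m, upsilonIntegrand d Q i j x t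
      (d i * x + d j * t + 2 * d i * d j * w) := by
    rw [intervalIntegral.integral_comp_add_mul _ hc, mul_zero, add_zero, upsilon, Matrix.of_apply,
      fMin_eq hd, ← hm, ← Complex.coe_smul, smul_eq_mul]
    push_cast
    rfl
  rw [h1, intervalIntegral.integral_of_le hm0, integral_Ioc_eq_integral_Ioo,
    ← integral_finsetSum _ fun k _ => (integrable_sum_line hd ha hb x t k).integrableOn]
  rw [setIntegral_congr_ae measurableSet_Ioo (ae_upsilonIntegrand_eq_sum hd hS hS' hQ hx.1 ht.1)]
  refine (setIntegral_eq_of_subset_of_forall_sdiff_eq_zero measurableSet_Ioc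
    (Ioo_subset_Ioc_self.trans (Ioc_subset_Ioc_right hml)) ?_).symm
  rintro w ⟨hw, hw'⟩
  refine Finset.sum_eq_zero fun k _ => ?_
  have h2 : m ≤ w := by
    by_contra h
    exact hw' ⟨hw.1, not_le.1 h⟩
  rcases min_le_iff.1 h2 with h | h
  · rw [(ha k).2.2 _ fun h' => ?_, zero_mul]
    have := (div_le_iff₀ hj).1 h
    linarith [h'.2]
  · rw [(hb k).2.2 _ fun h' => ?_, mul_zero]
    have := (div_le_iff₀ hi).1 h
    linarith [h'.2]

end Upsilon

/-! ### Regularity of `Υ` and recovery of `T` -/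

/-- A tail integral is absolutely continuous and can be differentiated almost everywhere. -/
theorem tail_integral_regularity {E : Type*} [NormedAddCommGroup E] [NormedSpace ℝ E]
    [CompleteSpace E] {l : ℝ} (hl : 0 < l) {k F : ℝ → E} (hk : Integrable k (intervalMeasure l))
    (hF : ∀ t ∈ Icc 0 l, F t = ∫ s in Ioi t, k s ∂(intervalMeasure l)) :
    AbsolutelyContinuousOnInterval F 0 l ∧
      ∀ᵐ t ∂(intervalMeasure l), HasDerivAt F (-k t) t := by
  have hi : IntervalIntegrable k volume 0 l :=
    (intervalIntegrable_iff_integrableOn_Ioo_of_le hl.le).2 hk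
  have hF' : ∀ t ∈ Icc 0 l, F t = (∫ s in (0 : ℝ)..l, k s) - ∫ s in (0 : ℝ)..t, k s := by
    intro t ht
    have hs : Ioi t ∩ Ioo 0 l = Ioo t l := by
      ext s
      simp only [mem_inter_iff, mem_Ioi, mem_Ioo]
      exact ⟨fun h => ⟨h.1, h.2.2⟩, fun h => ⟨h.1, ht.1.trans_lt h.1, h.2⟩⟩
    rw [hF t ht, Measure.restrict_restrict measurableSet_Ioi, hs, ← integral_Ioc_eq_integral_Ioo,
      ← intervalIntegral.integral_of_le ht.2, intervalIntegral.integral_interval_sub_left hi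
        (hi.mono_set (uIcc_subset_uIcc left_mem_uIcc (by rwa [uIcc_of_le hl.le])))]
  refine ⟨hi.absolutelyContinuousOnInterval_primitive.of_dist_le fun x hx y hy => ?_, ?_⟩
  · rw [uIcc_of_le hl.le] at hx hy
    rw [hF' x hx, hF' y hy, dist_sub_left]
  · filter_upwards [ae_restrict_of_ae hi.ae_hasDerivAt_integral,
      ae_restrict_mem measurableSet_Ioo] with t ht hmem
    have h1 := ht (by rw [uIcc_of_le hl.le]; exact Ioo_subset_Icc_self hmem) 0 left_mem_uIcc
    refine (h1.const_sub (∫ s in (0 : ℝ)..l, k s)).congr_of_eventuallyEq ?_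
    filter_upwards [Ioo_mem_nhds hmem.1 hmem.2] with s hs
    exact hF' s (Ioo_subset_Icc_self hs)

/-- The matrix function `Υ` is the kernel of the tail integrals of `T`. -/
theorem upsilon_eq_setIntegral {p : ℕ} {l : ℝ} {T : L2Vec p l →L[ℂ] L2Vec p l} {i j : Fin p}
    {y : ℂ} {x t : ℝ} (h : y = inner ℂ (stepVec l i x) (T (stepVec l j t))) :
    y = ∫ s in Ioi t, star (ContinuousLinearMap.adjoint T (stepVec l i x) s j)
      ∂(intervalMeasure l) := by
  rw [h, ← ContinuousLinearMap.adjoint_inner_left, ← inner_conj_symm, inner_stepVec,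
    ← integral_conj]
  rfl

theorem mainTheorem2 {p q : ℕ} (d : Fin p → ℝ) (hd : ∀ i, 0 < d i) (l : ℝ) (hl : 0 < l)
    (Q₁ : ℝ → Matrix (Fin p) (Fin q) ℂ) (Q₂ : ℝ → Matrix (Fin q) (Fin p) ℂ)
    (hQ₁ : ∀ i k, AEMeasurable (fun x => Q₁ x i k) (intervalMeasure l))
    (hQ₂ : ∀ k j, AEMeasurable (fun t => Q₂ t k j) (intervalMeasure l))
    (Q : ℝ → ℝ → Matrix (Fin p) (Fin p) ℂ) (hQ : ∀ x t, Q x t = Q₁ x * Q₂ t)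
    (T : L2Vec p l →L[ℂ] L2Vec p l)
    (hT : IsIntegralOperator
      (T.comp (opA d l) - (ContinuousLinearMap.adjoint (opA d l)).comp T)
      (fun x t => Complex.I • Q x t)) :
    -- the integrals defining `Υ(x, t)` converge absolutely
    (∀ x ∈ Icc 0 l, ∀ t ∈ Icc 0 l, ∀ i j,
      IntervalIntegrable (upsilonIntegrand d Q i j x t) volume
        (d i * x + d j * t) (fMin d l i j x t)) ∧
    -- `Υ` is absolutely continuous in `t`, so that `∂Υ/∂t` exists almost everywhere
    (∀ x ∈ Icc 0 l, ∀ i j,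
      AbsolutelyContinuousOnInterval (fun t => upsilon d l Q x t i j) 0 l ∧
      ∀ᵐ t ∂(intervalMeasure l), DifferentiableAt ℝ (fun τ => upsilon d l Q x τ i j) t) ∧
    -- `T f = d/dx ∫₀ˡ (∂Υ/∂t)(x, t) f(t) dt`
    (∀ f : L2Vec p l,
      (∀ x ∈ Icc 0 l,
        Integrable (fun t => Matrix.toEuclideanLin (dtUpsilon d l Q x t) (f t))
          (intervalMeasure l)) ∧
      AbsolutelyContinuousOnInterval
        (fun x => ∫ t, Matrix.toEuclideanLin (dtUpsilon d l Q x t) (f t) ∂(intervalMeasure l))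
        0 l ∧
      ∀ᵐ x ∂(intervalMeasure l),
        HasDerivAt
          (fun y => ∫ t, Matrix.toEuclideanLin (dtUpsilon d l Q y t) (f t) ∂(intervalMeasure l))
          (T f x) x) := by
  have key : ∀ i j : Fin p,
      (∀ x ∈ Icc 0 l, ∀ t ∈ Icc 0 l, IntervalIntegrable (upsilonIntegrand d Q i j x t) volume
        (d i * x + d j * t) (fMin d l i j x t)) ∧
      ∀ x ∈ Icc 0 l, ∀ t ∈ Icc 0 l,
        upsilon d l Q x t i j = inner ℂ (stepVec l i x) (T (stepVec l j t)) := by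
    intro i j
    obtain ⟨a, b, ha, hb, S, hS, S', hS', hab⟩ := exists_kernel_factors hQ₂ hQ hT i j
    refine ⟨fun x hx t ht => intervalIntegrable_upsilonIntegrand hd ha hb hS hS' hab hx ht,
      fun x hx t ht => ?_⟩
    rw [upsilon_eq_sum_integral hd ha hb hS hS' hab hx ht]
    exact (inner_stepVec_eq_sum_integral hd hl ha hb (fun x t hx ht =>
      inner_ramp_step_identity hT (fun k => (ha k).2) (fun k => (hb k).2) hS hS' hab hx ht)
      hx.1 ht.1).symm
  have hker : ∀ (x : ℝ) (i j : Fin p), Integrable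
      (fun s => star (ContinuousLinearMap.adjoint T (stepVec l i x) s j)) (intervalMeasure l) :=
    fun x i j => (((Lp.memLp (ContinuousLinearMap.adjoint T (stepVec l i x))).eval_piLp j).star).integrable
      one_le_two
  have hreg : ∀ x ∈ Icc 0 l, ∀ i j, _ := fun x hx i j =>
    tail_integral_regularity hl (hker x i j) fun t ht =>
      upsilon_eq_setIntegral ((key i j).2 x hx t ht)
  refine ⟨fun x hx t ht i j => (key i j).1 x hx t ht, fun x hx i j => ⟨(hreg x hx i j).1, ?_⟩,
    fun f => ?_⟩
  · filter_upwards [(hreg x hx i j).2] with t ht using ht.differentiableAt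
  -- Row `i` of `∂ₜΥ` consists of minus the conjugated components of `T* σ_i(x)`, so its product
  -- with `f t` is minus a pointwise inner product.
  have hval : ∀ x ∈ Icc 0 l, ∀ i,
      (fun t => Matrix.toEuclideanLin (dtUpsilon d l Q x t) (f t) i) =ᵐ[intervalMeasure l]
        fun t => -inner ℂ (ContinuousLinearMap.adjoint T (stepVec l i x) t) (f t) := by
    intro x hx i
    filter_upwards [ae_all_iff.2 fun j => (hreg x hx i j).2] with t ht
    change ∑ j, dtUpsilon d l Q x t i j * f t j = _
    rw [PiLp.inner_apply, ← Finset.sum_neg_distrib]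
    refine Finset.sum_congr rfl fun j _ => ?_
    rw [dtUpsilon, Matrix.of_apply, (ht j).deriv, RCLike.inner_apply, neg_mul, mul_comm]
    rfl
  have hint : ∀ x ∈ Icc 0 l, ∀ i, Integrable
      (fun t => Matrix.toEuclideanLin (dtUpsilon d l Q x t) (f t) i) (intervalMeasure l) :=
    fun x hx i => (L2.integrable_inner _ f).neg.congr (hval x hx i).symm
  have hTf : Integrable (fun s => -T f s) (intervalMeasure l) := (L2Vec.integrable (T f)).neg
  -- The integral of `∂ₜΥ f` is the tail integral of `-T f`; differentiating a tail gives a second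
  -- minus sign, which leaves `T f`.
  have htail := tail_integral_regularity hl hTf
    (F := fun x => ∫ t, Matrix.toEuclideanLin (dtUpsilon d l Q x t) (f t) ∂(intervalMeasure l))
    fun x hx => by
      ext i
      rw [eval_integral_piLp (hint x hx), integral_congr_ae (hval x hx i), integral_neg,
        ← L2.inner_def, ContinuousLinearMap.adjoint_inner_left, inner_stepVec,
        eval_integral_piLp fun i => (hTf.restrict (s := Ioi x)).eval_piLp i, ← integral_neg]
      rfl
  refine ⟨fun x hx => Integrable.of_eval_piLp (hint x hx), htail.1, ?_⟩
  simpa using htail.2
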